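/- Let $(\tilde M,\varphi,\xi,\eta,g)$ be a Sasakian manifold (a normal contact metric manifold; equivalently, an almost contact metric manifold with $(\tilde\nabla_X\varphi)Y=g(X,Y)\xi-\eta(Y)X$ for the Levi-Civita connection $\tilde\nabla$). Let $M=M_T\times_f M_\theta$ be a warped product of Riemannian manifolds $M_T$ (connected) and $M_\theta$, with a smooth positive warping function $f$ on $M_T$, isometrically immersed in $\tilde M$ so that $\xi$ is tangent to $M$. Suppose that $M$ is a warped product pointwise semi-slant submanifold: the leaves $M_T\times\{y\}$ are invariant ($\varphi$ maps their tangent spaces into themselves) and the leaves $\{x\}\times M_\theta$ are pointwise slant (at each point $p$, the angle $\theta(p)$ between $\varphi Z$ and the tangent space of the leaf is the same for all tangent vectors $Z$ of the leaf at $p$ that are not proportional to $\xi_p$). Let $h$ be the second fundamental form of $M$ in $\tilde M$, and suppose that $M$ is mixed totally geodesic: $h(X,Z)=0$ for all $X$ tangent to $M_T$ and orthogonal to $\xi$ and all $Z$ tangent to $M_\theta$ (in particular, this holds if $h(X,Z)=0$ for all $X$ tangent to $M_T$ and all $Z$ tangent to $M_\theta$). Then either $M$ is a contact CR-warped product $M_T\times_f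 M_\perp$ (that is, $\xi$ is tangent to the invariant leaves $M_T\times\{y\}$, and the leaves $\{x\}\times M_\theta$ are anti-invariant: $\varphi$ maps their tangent spaces into their normal spaces), or $f$ is constant. -/

import Mathlib

open scoped Manifold ContDiff Bundle Topology

noncomputable section

namespace SasakianWarped

/-! ### The ambient manifold

`M` is a smooth manifold without boundary modelled on the finite-dimensional space `E`; its
Riemannian metric `g` is the smooth inner product `inner ℝ` on the tangent spaces. -/

section Ambient

variable {E : Type*} [NormedAddCommGroup E] [NormedSpace ℝ E]
  {M : Type*} [TopologicalSpace M] [ChartedSpace E M] [IsManifold 𝓘(ℝ, E) ∞ M]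
  [Bundle.RiemannianBundle (fun q : M ↦ TangentSpace 𝓘(ℝ, E) q)]

variable (E M) in
/-- An almost contact metric structure `(φ, ξ, η, g)` on `M`, where `g` is the given
Riemannian metric of `M`. -/
structure AlmostContactMetricStructure where
  /-- The `(1,1)`-tensor field `φ`. -/
  φ : ∀ q : M, TangentSpace 𝓘(ℝ, E) q →L[ℝ] TangentSpace 𝓘(ℝ, E) q
  /-- The Reeb (characteristic) vector field `ξ`. -/
  ξ : ∀ q : M, TangentSpace 𝓘(ℝ, E) q
  /-- The 1-form `η`. -/
  η : ∀ q : M, TangentSpace 𝓘(ℝ, E) q →L[ℝ] ℝ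
  smooth_φ : ContMDiff 𝓘(ℝ, E) (𝓘(ℝ, E).prod 𝓘(ℝ, E →L[ℝ] E)) ∞
    (fun q : M ↦ Bundle.TotalSpace.mk' (E →L[ℝ] E)
      (E := fun q : M ↦ TangentSpace 𝓘(ℝ, E) q →L[ℝ] TangentSpace 𝓘(ℝ, E) q) q (φ q))
  smooth_ξ : ContMDiff 𝓘(ℝ, E) (𝓘(ℝ, E).prod 𝓘(ℝ, E)) ∞
    (fun q : M ↦ Bundle.TotalSpace.mk' E (E := fun q : M ↦ TangentSpace 𝓘(ℝ, E) q) q (ξ q))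
  smooth_η : ContMDiff 𝓘(ℝ, E) (𝓘(ℝ, E).prod 𝓘(ℝ, E →L[ℝ] ℝ)) ∞
    (fun q : M ↦ Bundle.TotalSpace.mk' (E →L[ℝ] ℝ)
      (E := fun q : M ↦ TangentSpace 𝓘(ℝ, E) q →L[ℝ] Bundle.Trivial M ℝ q) q (η q))
  φ_φ : ∀ (q : M) (x : TangentSpace 𝓘(ℝ, E) q), φ q (φ q x) = -x + η q x • ξ q
  η_ξ : ∀ q : M, η q (ξ q) = 1
  compatible : ∀ (q : M) (x y : TangentSpace 𝓘(ℝ, E) q),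
    inner ℝ (φ q x) (φ q y) = inner ℝ x y - η q x * η q y

namespace AlmostContactMetricStructure

variable (S : AlmostContactMetricStructure E M)

/-- The vector field `φ X`. -/
def app (X : ∀ q : M, TangentSpace 𝓘(ℝ, E) q) : ∀ q : M, TangentSpace 𝓘(ℝ, E) q :=
  fun q ↦ S.φ q (X q)

/-- The exterior derivative of `η`, in the convention
`dη(X, Y) = (X(η(Y)) - Y(η(X)) - η([X, Y])) / 2`. -/
def dη (X Y : ∀ q : M, TangentSpace 𝓘(ℝ, E) q) (q : M) : ℝ :=
  (1 / 2 : ℝ) * (d% (fun q' : M ↦ S.η q' (Y q')) q (X q) - d% (fun q' : M ↦ S.η q' (X q')) q (Y q)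
    - S.η q (VectorField.mlieBracket 𝓘(ℝ, E) X Y q))

/-- The Nijenhuis torsion
`[φ, φ](X, Y) = φ²[X, Y] + [φX, φY] - φ[φX, Y] - φ[X, φY]` of `φ`. -/
def nijenhuis (X Y : ∀ q : M, TangentSpace 𝓘(ℝ, E) q) (q : M) : TangentSpace 𝓘(ℝ, E) q :=
  S.φ q (S.φ q (VectorField.mlieBracket 𝓘(ℝ, E) X Y q))
    + VectorField.mlieBracket 𝓘(ℝ, E) (S.app X) (S.app Y) q
    - S.φ q (VectorField.mlieBracket 𝓘(ℝ, E) (S.app X) Y q)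
    - S.φ q (VectorField.mlieBracket 𝓘(ℝ, E) X (S.app Y) q)

/-- A contact metric structure: `dη(X, Y) = g(X, φY)`. -/
def IsContactMetric : Prop :=
  ∀ (q : M) (X Y : ∀ q : M, TangentSpace 𝓘(ℝ, E) q),
    MDiffAt (T% X) q → MDiffAt (T% Y) q → S.dη X Y q = inner ℝ (X q) (S.φ q (Y q))

/-- Normality: `[φ, φ] + 2 dη ⊗ ξ = 0`. -/
def IsNormal : Prop :=
  ∀ (q : M) (X Y : ∀ q : M, TangentSpace 𝓘(ℝ, E) q),
    MDiffAt (T% X) q → MDiffAt (T% Y) q → S.nijenhuis X Y q + (2 * S.dη X Y q) • S.ξ q = 0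

/-- A Sasakian structure is a normal contact metric structure. -/
def IsSasakian : Prop := S.IsContactMetric ∧ S.IsNormal

end AlmostContactMetricStructure

/-- `nabla` is the Levi-Civita connection of the Riemannian metric of `M`: it is metric,
`X g(Y, Z) = g(∇_X Y, Z) + g(Y, ∇_X Z)`, and torsion-free. Here `∇_X Y` at `q` is
`nabla Y q (X q)`. -/
def IsLeviCivita [FiniteDimensional ℝ E]
    (nabla : CovariantDerivative 𝓘(ℝ, E) E (fun q : M ↦ TangentSpace 𝓘(ℝ, E) q)) : Prop :=
  (∀ (q : M) (X Y Z : ∀ q : M, TangentSpace 𝓘(ℝ, E) q),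
    MDiffAt (T% X) q → MDiffAt (T% Y) q → MDiffAt (T% Z) q →
      d% (fun q' : M ↦ inner ℝ (Y q') (Z q')) q (X q)
        = inner ℝ (nabla Y q (X q)) (Z q) + inner ℝ (Y q) (nabla Z q (X q))) ∧
  nabla.torsion = 0

end Ambient

/-! ### Immersed submanifolds

A submanifold is given by a smooth map `j : N → M` whose differentials are injective; its tangent
space at `p`, as a subspace of the tangent space of `M` at `j p`, is `tangentRange j p`. -/

section Submanifold

variable {E : Type*} [NormedAddCommGroup E] [NormedSpace ℝ E]
  {M : Type*} [TopologicalSpace M] [ChartedSpace E M]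
  {E₁ : Type*} [NormedAddCommGroup E₁] [NormedSpace ℝ E₁]
  {H₁ : Type*} [TopologicalSpace H₁] {I₁ : ModelWithCorners ℝ E₁ H₁}
  {N : Type*} [TopologicalSpace N] [ChartedSpace H₁ N]

variable (E I₁) in
/-- The image of the tangent space of `N` at `p` in the tangent space of `M` at `j p`. -/
def tangentRange (j : N → M) (p : N) : Submodule ℝ (TangentSpace 𝓘(ℝ, E) (j p)) :=
  LinearMap.range (mfderiv I₁ 𝓘(ℝ, E) j p).toLinearMap

variable [IsManifold 𝓘(ℝ, E) ∞ M]
  [Bundle.RiemannianBundle (fun q : M ↦ TangentSpace 𝓘(ℝ, E) q)]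

/-- The component of `v` orthogonal to the subspace `W` of a tangent space of `M`. -/
def normalPart [FiniteDimensional ℝ E] {q : M} (W : Submodule ℝ (TangentSpace 𝓘(ℝ, E) q))
    (v : TangentSpace 𝓘(ℝ, E) q) : TangentSpace 𝓘(ℝ, E) q :=
  haveI : FiniteDimensional ℝ (TangentSpace 𝓘(ℝ, E) q) := inferInstanceAs (FiniteDimensional ℝ E)
  Wᗮ.starProjection v

/-- The angle between the vector `v` and the subspace `W`, that is, the angle in `[0, π/2]`
between `v` and its orthogonal projection `v - normalPart W v` to `W`
(it is `π/2` if `v ≠ 0` is orthogonal to `W`). -/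
def angleWithSubspace [FiniteDimensional ℝ E] {q : M}
    (W : Submodule ℝ (TangentSpace 𝓘(ℝ, E) q)) (v : TangentSpace 𝓘(ℝ, E) q) : ℝ :=
  InnerProductGeometry.angle v (v - normalPart W v)

variable (S : AlmostContactMetricStructure E M)

variable (I₁) in
/-- `j : N → M` is an invariant submanifold: `φ` maps every tangent space of `N` into itself. -/
def IsInvariant (j : N → M) : Prop :=
  ∀ p : N, ∀ v ∈ tangentRange E I₁ j p, S.φ (j p) v ∈ tangentRange E I₁ j p

variable (I₁) in
/-- `j : N → M` is an anti-invariant submanifold: `φ` maps every tangent space of `N` into the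
normal space. -/
def IsAntiInvariant (j : N → M) : Prop :=
  ∀ p : N, ∀ v ∈ tangentRange E I₁ j p, ∀ w ∈ tangentRange E I₁ j p,
    inner ℝ (S.φ (j p) v) w = 0

variable (I₁) in
/-- `j : N → M` is a pointwise slant submanifold with slant function `θ`: for every vector `v`
tangent to `N` at `p` and not proportional to `ξ`, the angle between `φ v` and the tangent space
of `N` at `p` is `θ p`, independently of `v`. -/
def IsPointwiseSlant [FiniteDimensional ℝ E] (j : N → M) (θ : N → ℝ) : Prop :=
  ∀ p : N, ∀ v ∈ tangentRange E I₁ j p, v ∉ Submodule.span ℝ {S.ξ (j p)} →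
    angleWithSubspace (tangentRange E I₁ j p) (S.φ (j p) v) = θ p

variable (I₁) in
/-- The Reeb vector field `ξ` is tangent to the submanifold `j : N → M`. -/
def ReebTangent (j : N → M) : Prop :=
  ∀ p : N, S.ξ (j p) ∈ tangentRange E I₁ j p

variable (I₁) in
/-- The vector field `Y'` of `M` is smooth near `j p` and extends, near `p`, the vector field `Y`
of `N`, which is smooth near `p`. -/
def IsExtensionAt [IsManifold I₁ ∞ N] (j : N → M) (p : N) (Y : ∀ p : N, TangentSpace I₁ p)
    (Y' : ∀ q : M, TangentSpace 𝓘(ℝ, E) q) : Prop :=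
  ContMDiffAt I₁ I₁.tangent ∞ (fun p' : N ↦ (⟨p', Y p'⟩ : TangentBundle I₁ N)) p ∧
  ContMDiffAt 𝓘(ℝ, E) 𝓘(ℝ, E).tangent ∞
    (fun q : M ↦ (⟨q, Y' q⟩ : TangentBundle 𝓘(ℝ, E) M)) (j p) ∧
  ∀ᶠ p' in 𝓝 p, Y' (j p') = mfderiv I₁ 𝓘(ℝ, E) j p' (Y p')

variable (I₁) in
/-- The second fundamental form of `j : N → M` by the Gauss formula: if `Y'` extends the vector
field `Y` of `N` near `p`, then `h(x, Y)` is the normal component of `∇_x Y'` at `j p`, for `x`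
tangent to `N` at `p`. -/
def secondFundamentalForm [FiniteDimensional ℝ E]
    (nabla : CovariantDerivative 𝓘(ℝ, E) E (fun q : M ↦ TangentSpace 𝓘(ℝ, E) q))
    (j : N → M) (p : N) (x : TangentSpace I₁ p) (Y' : ∀ q : M, TangentSpace 𝓘(ℝ, E) q) :
    TangentSpace 𝓘(ℝ, E) (j p) :=
  normalPart (tangentRange E I₁ j p) (nabla Y' (j p) (mfderiv I₁ 𝓘(ℝ, E) j p x))

end Submanifold

/-! ### Warped product submanifolds

`MT` and `Mθ` are Riemannian manifolds, and the manifold `MT × Mθ` is mapped to `M` by `ι`. -/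

section WarpedProduct

variable {E : Type*} [NormedAddCommGroup E] [NormedSpace ℝ E] [FiniteDimensional ℝ E]
  {M : Type*} [TopologicalSpace M] [ChartedSpace E M] [IsManifold 𝓘(ℝ, E) ∞ M]
  [Bundle.RiemannianBundle (fun q : M ↦ TangentSpace 𝓘(ℝ, E) q)]
  {E₁ : Type*} [NormedAddCommGroup E₁] [NormedSpace ℝ E₁]
  {MT : Type*} [TopologicalSpace MT] [ChartedSpace E₁ MT] [IsManifold 𝓘(ℝ, E₁) ∞ MT]
  [Bundle.RiemannianBundle (fun p : MT ↦ TangentSpace 𝓘(ℝ, E₁) p)]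
  {E₂ : Type*} [NormedAddCommGroup E₂] [NormedSpace ℝ E₂]
  {Mθ : Type*} [TopologicalSpace Mθ] [ChartedSpace E₂ Mθ] [IsManifold 𝓘(ℝ, E₂) ∞ Mθ]
  [Bundle.RiemannianBundle (fun p : Mθ ↦ TangentSpace 𝓘(ℝ, E₂) p)]

variable (E₁ E₂) in
/-- The warped product metric `g₁(π₁₊X, π₁₊Y) + (f ∘ π₁)² g₂(π₂₊X, π₂₊Y)` on `MT × Mθ`, where
`π₁₊` and `π₂₊` are the tangent maps of the projections. -/
def warpedMetric (f : MT → ℝ) (p : MT × Mθ)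
    (X Y : TangentSpace (𝓘(ℝ, E₁).prod 𝓘(ℝ, E₂)) p) : ℝ :=
  inner ℝ (mfderiv (𝓘(ℝ, E₁).prod 𝓘(ℝ, E₂)) 𝓘(ℝ, E₁) Prod.fst p X)
      (mfderiv (𝓘(ℝ, E₁).prod 𝓘(ℝ, E₂)) 𝓘(ℝ, E₁) Prod.fst p Y)
    + f p.1 ^ 2 * inner ℝ (mfderiv (𝓘(ℝ, E₁).prod 𝓘(ℝ, E₂)) 𝓘(ℝ, E₂) Prod.snd p X)
      (mfderiv (𝓘(ℝ, E₁).prod 𝓘(ℝ, E₂)) 𝓘(ℝ, E₂) Prod.snd p Y)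

variable (E E₁ E₂) in
/-- `ι` is an isometric immersion in `M` of the warped product `MT ×_f Mθ`, with the smooth and
positive warping function `f` on `MT`. -/
structure IsWarpedProductSubmanifold (f : MT → ℝ) (ι : MT × Mθ → M) : Prop where
  smooth_f : ContMDiff 𝓘(ℝ, E₁) 𝓘(ℝ, ℝ) ∞ f
  pos_f : ∀ p, 0 < f p
  smooth_ι : ContMDiff (𝓘(ℝ, E₁).prod 𝓘(ℝ, E₂)) 𝓘(ℝ, E) ∞ ι
  isometric : ∀ (p : MT × Mθ) (X Y : TangentSpace (𝓘(ℝ, E₁).prod 𝓘(ℝ, E₂)) p),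
    inner ℝ (mfderiv (𝓘(ℝ, E₁).prod 𝓘(ℝ, E₂)) 𝓘(ℝ, E) ι p X)
      (mfderiv (𝓘(ℝ, E₁).prod 𝓘(ℝ, E₂)) 𝓘(ℝ, E) ι p Y) = warpedMetric E₁ E₂ f p X Y

variable (S : AlmostContactMetricStructure E M)

variable (E₁ E₂) in
/-- A warped product pointwise semi-slant submanifold `MT ×_f Mθ`, tangent to `ξ`: the leaves
`MT × {y}` are invariant submanifolds of `M`, and the leaves `{x} × Mθ` are pointwise slant
submanifolds of `M`, with a slant function `θ` on `MT × Mθ`. -/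
structure IsWarpedProductPointwiseSemiSlant (f : MT → ℝ) (ι : MT × Mθ → M) : Prop where
  warped : IsWarpedProductSubmanifold E E₁ E₂ f ι
  reeb_tangent : ReebTangent (𝓘(ℝ, E₁).prod 𝓘(ℝ, E₂)) S ι
  invariant : ∀ y : Mθ, IsInvariant 𝓘(ℝ, E₁) S (fun x : MT ↦ ι (x, y))
  slant : ∃ θ : MT × Mθ → ℝ,
    ∀ x : MT, IsPointwiseSlant 𝓘(ℝ, E₂) S (fun y : Mθ ↦ ι (x, y)) (fun y ↦ θ (x, y))

variable (E₁ E₂) in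
/-- A contact CR-warped product `MT ×_f M⊥`: the leaves `MT × {y}` are invariant submanifolds of
`M` tangent to `ξ`, and the leaves `{x} × M⊥` are anti-invariant submanifolds of `M`. -/
structure IsContactCRWarpedProduct (f : MT → ℝ) (ι : MT × Mθ → M) : Prop where
  warped : IsWarpedProductSubmanifold E E₁ E₂ f ι
  reeb_tangent : ∀ y : Mθ, ReebTangent 𝓘(ℝ, E₁) S (fun x : MT ↦ ι (x, y))
  invariant : ∀ y : Mθ, IsInvariant 𝓘(ℝ, E₁) S (fun x : MT ↦ ι (x, y))
  antiInvariant : ∀ x : MT, IsAntiInvariant 𝓘(ℝ, E₂) S (fun y : Mθ ↦ ι (x, y))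

variable (E₁ E₂) in
/-- `MT ×_f Mθ` is mixed totally geodesic: `h(X, Z) = 0` for `X` tangent to `MT` and orthogonal to
`ξ`, and `Z` tangent to `Mθ`.

Only the `X` orthogonal to `ξ` are considered. This is weaker than `h(X, Z) = 0` for all `X` tangent
to `MT`; on a Sasakian manifold `h(ξ, Z)` is the opposite of the normal component of `φ Z`. -/
def IsMixedTotallyGeodesic
    (nabla : CovariantDerivative 𝓘(ℝ, E) E (fun q : M ↦ TangentSpace 𝓘(ℝ, E) q))
    (ι : MT × Mθ → M) : Prop :=
  ∀ (p : MT × Mθ) (X : TangentSpace (𝓘(ℝ, E₁).prod 𝓘(ℝ, E₂)) p)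
    (Z : ∀ p : MT × Mθ, TangentSpace (𝓘(ℝ, E₁).prod 𝓘(ℝ, E₂)) p)
    (Z' : ∀ q : M, TangentSpace 𝓘(ℝ, E) q),
    IsExtensionAt (𝓘(ℝ, E₁).prod 𝓘(ℝ, E₂)) ι p Z Z' →
    mfderiv (𝓘(ℝ, E₁).prod 𝓘(ℝ, E₂)) 𝓘(ℝ, E₂) Prod.snd p X = 0 →
    S.η (ι p) (mfderiv (𝓘(ℝ, E₁).prod 𝓘(ℝ, E₂)) 𝓘(ℝ, E) ι p X) = 0 →
    (∀ p', mfderiv (𝓘(ℝ, E₁).prod 𝓘(ℝ, E₂)) 𝓘(ℝ, E₁) Prod.fst p' (Z p') = 0) →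
    secondFundamentalForm (𝓘(ℝ, E₁).prod 𝓘(ℝ, E₂)) nabla ι p X Z' = 0

end WarpedProduct

end SasakianWarped

end

/-! Two facts about `η` decide everything: `dη(X, Y) = g(X, φY)` and `φξ = 0`. At each point `ξ`
lies in the tangent space of exactly one of the two leaves. If `η(v) ≠ 0` for some `v` tangent to
the invariant leaf, then `φ²v + v = η(v)ξ` puts `ξ` in that leaf. Otherwise `ξ` is orthogonal to
that leaf and so tangent to the other one. Either alternative amounts to `η` being nonzero on some
vector of one leaf, an open condition, so the set where `ξ` is tangent to the invariant leaf is
clopen (`isClopen_setOf_reeb_left`).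

If that set is everything, `η` vanishes on the leaves `{x} × Mθ`. So does the pullback of `dη`, and
`g(X, φY) = 0` there: these leaves are anti-invariant (`isAntiInvariant_right`).

Otherwise some `(x₀, y₀)` lies outside it, and by connectedness of `MT` so does all of `MT × {y₀}`.
Let `β` be the pullback of `η`, and let `k` be the vector tangent to `Mθ` that represents `ξ` at a
point. Near that point `β` vanishes on the `MT` directions, and `dβ(h, k) = 2g(h, φξ) = 0`, so
`β(k)` is stationary along the `MT` directions. By Cauchy–Schwarz `β(k)² ≤ f²|k|²`, with equality at
the point. Hence `f²|k|² - β(k)²` has a minimum there, and `df = 0` follows (`mfderiv_f_eq_zero`).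

Exterior derivatives are computed in charts, as antisymmetrised Fréchet derivatives. -/

namespace SasakianWarped

/-! ### Exterior derivative of a pulled-back 1-form -/

section ChartForm

variable {F E : Type*} [NormedAddCommGroup F] [NormedSpace ℝ F] [NormedAddCommGroup E]
  [NormedSpace ℝ E]

/-- Pulling back a 1-form along a `C^2` map commutes with the exterior derivative. -/
theorem fderiv_pullback_antisymm {u : F → E} {α : E → E →L[ℝ] ℝ} {z : F}
    (hu : ContDiffAt ℝ 2 u z) (hα : DifferentiableAt ℝ α (u z)) :
    DifferentiableAt ℝ (fun z' ↦ (α (u z')).comp (fderiv ℝ u z')) z ∧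
    ∀ h k : F,
      fderiv ℝ (fun z' ↦ (α (u z')).comp (fderiv ℝ u z')) z h k
        - fderiv ℝ (fun z' ↦ (α (u z')).comp (fderiv ℝ u z')) z k h
      = fderiv ℝ α (u z) (fderiv ℝ u z h) (fderiv ℝ u z k)
        - fderiv ℝ α (u z) (fderiv ℝ u z k) (fderiv ℝ u z h) := by
  have hu1 : DifferentiableAt ℝ u z := hu.differentiableAt (by norm_num)
  have hdu : DifferentiableAt ℝ (fderiv ℝ u) z :=
    (hu.fderiv_right (m := 1) (by norm_num)).differentiableAt (by norm_num)
  have hsymm : IsSymmSndFDerivAt ℝ u z := hu.isSymmSndFDerivAt (by simp)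
  have key := (hα.hasFDerivAt.comp z hu1.hasFDerivAt).clm_comp hdu.hasFDerivAt
  refine ⟨key.differentiableAt, fun h k ↦ ?_⟩
  have e : fderiv ℝ (fun z' ↦ (α (u z')).comp (fderiv ℝ u z')) z = _ := key.fderiv
  rw [e]
  -- The terms containing the second derivative of `u` cancel by its symmetry.
  have := hsymm h k
  simp [this]

end ChartForm

variable {E : Type*} [NormedAddCommGroup E] [NormedSpace ℝ E]
  {M : Type*} [TopologicalSpace M] [ChartedSpace E M] [IsManifold 𝓘(ℝ, E) ∞ M]
  [Bundle.RiemannianBundle (fun q : M ↦ TangentSpace 𝓘(ℝ, E) q)]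
  (S : AlmostContactMetricStructure E M)

/-! ### Pointwise algebra of `φ`, `ξ`, `η` -/

namespace AlmostContactMetricStructure

/-- Since `φ²ξ = -ξ + ξ = 0`, evaluating `φ²` on `φξ` gives `φξ = cξ` with `c = η(φξ)`. Then `0 =
φ²ξ = c²ξ`, and applying `η` gives `c = 0`. -/
theorem φ_ξ (q : M) : S.φ q (S.ξ q) = 0 := by
  have h1 : S.φ q (S.φ q (S.ξ q)) = 0 := by rw [S.φ_φ, S.η_ξ]; simp
  have h2 := S.φ_φ q (S.φ q (S.ξ q))
  rw [h1, map_zero] at h2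
  have h3 : S.φ q (S.ξ q) = S.η q (S.φ q (S.ξ q)) • S.ξ q := by
    rw [eq_comm, neg_add_eq_zero] at h2; exact h2
  set c := S.η q (S.φ q (S.ξ q)) with hc
  have h4 : S.φ q (S.φ q (S.ξ q)) = c • c • S.ξ q := by
    rw [h3, map_smul, h3]
  rw [h1] at h4
  have h5 := congrArg (S.η q) h4
  simp only [map_zero, map_smul, S.η_ξ, smul_eq_mul, mul_one] at h5
  have : c = 0 := by simpa using h5.symm
  rw [h3, this, zero_smul]

theorem inner_ξ (q : M) (x : TangentSpace 𝓘(ℝ, E) q) : inner ℝ x (S.ξ q) = S.η q x := by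
  have h := S.compatible q x (S.ξ q)
  rw [S.φ_ξ, inner_zero_right, S.η_ξ] at h
  linarith

theorem inner_ξ_ξ (q : M) : inner ℝ (S.ξ q) (S.ξ q) = (1 : ℝ) := by
  rw [S.inner_ξ, S.η_ξ]

/-- Cauchy–Schwarz against the unit vector `ξ`; the defect is `|φx|²`. -/
theorem sq_η_le (q : M) (x : TangentSpace 𝓘(ℝ, E) q) : S.η q x ^ 2 ≤ inner ℝ x x := by
  have h := S.compatible q x x
  have h0 : 0 ≤ (inner ℝ (S.φ q x) (S.φ q x) : ℝ) := real_inner_self_nonneg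
  nlinarith

/-- If a `φ`-invariant subspace does not lie in the kernel of `η`, then it contains `ξ`. -/
theorem ξ_mem_of_invariant {q : M} {W : Submodule ℝ (TangentSpace 𝓘(ℝ, E) q)}
    (hW : ∀ v ∈ W, S.φ q v ∈ W) {v : TangentSpace 𝓘(ℝ, E) q} (hv : v ∈ W) (h : S.η q v ≠ 0) :
    S.ξ q ∈ W := by
  -- The vector `φ²v + v = η(v)ξ` stays in `W`.
  have h1 := W.add_mem (hW _ (hW _ hv)) hv
  rw [S.φ_φ, neg_add_cancel_comm] at h1
  exact (W.smul_mem_iff h).1 h1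

/-! ### The contact condition in a chart -/

/-- The 1-form `η` in the extended chart at `q₀`. -/
noncomputable def chartForm (q₀ : M) (w : E) : E →L[ℝ] ℝ :=
  (S.η ((extChartAt 𝓘(ℝ, E) q₀).symm w)).comp
    (mfderiv 𝓘(ℝ, E) 𝓘(ℝ, E) (extChartAt 𝓘(ℝ, E) q₀).symm w)

omit [Bundle.RiemannianBundle (fun q : M ↦ TangentSpace 𝓘(ℝ, E) q)] in
theorem mfderiv_extChartAt_symm_eq_symmL {q₀ : M} {w : E}
    (hw : w ∈ (extChartAt 𝓘(ℝ, E) q₀).target) :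
    mfderiv 𝓘(ℝ, E) 𝓘(ℝ, E) (extChartAt 𝓘(ℝ, E) q₀).symm w =
      (trivializationAt E (fun q : M ↦ TangentSpace 𝓘(ℝ, E) q) q₀).symmL ℝ
        ((extChartAt 𝓘(ℝ, E) q₀).symm w) := by
  have hs : (extChartAt 𝓘(ℝ, E) q₀).symm w ∈ (chartAt E q₀).source := by
    have := (extChartAt 𝓘(ℝ, E) q₀).map_target hw
    rwa [extChartAt_source] at this
  have h := TangentBundle.symmL_trivializationAt (I := 𝓘(ℝ, E)) hs
  simp only [modelWithCornersSelf_coe, Set.range_id, mfderivWithin_univ] at h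
  -- The types depend on the base point, so the equality of points is transported by substitution
  -- instead of rewriting.
  have aux : ∀ w', w' = w → (mfderiv 𝓘(ℝ, E) 𝓘(ℝ, E) (extChartAt 𝓘(ℝ, E) q₀).symm w' : E →L[ℝ] E) =
      mfderiv 𝓘(ℝ, E) 𝓘(ℝ, E) (extChartAt 𝓘(ℝ, E) q₀).symm w := by rintro _ rfl; rfl
  exact (h.trans (aux _ ((extChartAt 𝓘(ℝ, E) q₀).right_inv hw))).symm

/-- Identifies the chart form with the coordinate expression of `η` in the hom bundle, for which
`smooth_η` gives differentiability. -/
theorem chartForm_eventuallyEq (q₀ : M) : S.chartForm q₀ =ᶠ[𝓝 (extChartAt 𝓘(ℝ, E) q₀ q₀)]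
    fun w ↦ ContinuousLinearMap.inCoordinates E (fun q : M ↦ TangentSpace 𝓘(ℝ, E) q) ℝ
      (fun q : M ↦ Bundle.Trivial M ℝ q) q₀ ((extChartAt 𝓘(ℝ, E) q₀).symm w) q₀
      ((extChartAt 𝓘(ℝ, E) q₀).symm w) (S.η ((extChartAt 𝓘(ℝ, E) q₀).symm w)) := by
  filter_upwards [extChartAt_target_mem_nhds (I := 𝓘(ℝ, E)) q₀] with w hw
  ext v
  simp only [chartForm, ContinuousLinearMap.inCoordinates]
  rw [mfderiv_extChartAt_symm_eq_symmL hw]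
  simp

theorem differentiableAt_chartForm (q₀ : M) :
    DifferentiableAt ℝ (S.chartForm q₀) (extChartAt 𝓘(ℝ, E) q₀ q₀) := by
  refine DifferentiableAt.congr_of_eventuallyEq ?_ (S.chartForm_eventuallyEq q₀)
  have h := ((contMDiffAt_hom_bundle _).1 (S.smooth_η q₀)).2
  have hc : ContMDiffAt 𝓘(ℝ, E) 𝓘(ℝ, E) ∞ (extChartAt 𝓘(ℝ, E) q₀).symm
      (extChartAt 𝓘(ℝ, E) q₀ q₀) :=
    (contMDiffOn_extChartAt_symm q₀).contMDiffAt (extChartAt_target_mem_nhds q₀)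
  have h2 := ContMDiffAt.comp_of_eq (x := extChartAt 𝓘(ℝ, E) q₀ q₀) h hc (extChartAt_to_inv q₀)
  exact (contMDiffAt_iff_contDiffAt.1 h2).differentiableAt (by simp)

/-- The coordinate vector field of the extended chart at `q₀` with constant value `v`. -/
noncomputable def chartField (q₀ : M) (v : E) (q : M) : TangentSpace 𝓘(ℝ, E) q :=
  (trivializationAt E (fun q : M ↦ TangentSpace 𝓘(ℝ, E) q) q₀).symmL ℝ q v

omit [Bundle.RiemannianBundle (fun q : M ↦ TangentSpace 𝓘(ℝ, E) q)] in
theorem mdifferentiableAt_chartField (q₀ : M) (v : E) : MDiffAt (T% (chartField q₀ v)) q₀ := by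
  refine (mdifferentiableAt_section ..).2 ?_
  refine (mdifferentiableAt_const (c := v)).congr_of_eventuallyEq ?_
  filter_upwards [(trivializationAt E (fun q : M ↦ TangentSpace 𝓘(ℝ, E) q) q₀).open_baseSet.mem_nhds
    (FiberBundle.mem_baseSet_trivializationAt' q₀)] with q hq
  rw [show chartField q₀ v q = (trivializationAt E (fun q : M ↦ TangentSpace 𝓘(ℝ, E) q) q₀).symm q v
    from Bundle.Trivialization.symmL_apply _ hq _]
  exact congrArg Prod.snd (Bundle.Trivialization.apply_mk_symm _ hq v)

omit [Bundle.RiemannianBundle (fun q : M ↦ TangentSpace 𝓘(ℝ, E) q)] in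
-- Pulled back by the inverse chart, coordinate fields become constant, and constant fields commute.
-- This removes the bracket term from `dη`.
theorem mlieBracket_chartField (q₀ : M) (v w : E) :
    VectorField.mlieBracket 𝓘(ℝ, E) (chartField q₀ v) (chartField q₀ w) q₀ = 0 := by
  have key : ∀ v : E, VectorField.mpullbackWithin 𝓘(ℝ, E) 𝓘(ℝ, E) (extChartAt 𝓘(ℝ, E) q₀).symm
      (chartField q₀ v) (Set.range 𝓘(ℝ, E)) =ᶠ[𝓝 (extChartAt 𝓘(ℝ, E) q₀ q₀)] fun _ ↦ v := by
    intro v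
    filter_upwards [extChartAt_target_mem_nhds (I := 𝓘(ℝ, E)) q₀] with z hz
    rw [VectorField.mpullbackWithin_apply]
    have hi := isInvertible_mfderivWithin_extChartAt_symm (I := 𝓘(ℝ, E)) hz
    refine hi.inverse_apply_eq.2 ?_
    simp only [modelWithCornersSelf_coe, Set.range_id, mfderivWithin_univ]
    rw [mfderiv_extChartAt_symm_eq_symmL hz]
    rfl
  rw [← VectorField.mlieBracketWithin_univ, VectorField.mlieBracketWithin_apply]
  simp only [Set.preimage_univ, modelWithCornersSelf_coe, Set.range_id, Set.univ_inter]
  have h := Filter.EventuallyEq.lieBracket_vectorField_eq (𝕜 := ℝ) (key v) (key w)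
  simp only [modelWithCornersSelf_coe, Set.range_id] at h
  have h0 : VectorField.lieBracket ℝ (fun _ : E ↦ v) (fun _ ↦ w) (extChartAt 𝓘(ℝ, E) q₀ q₀) = 0 := by
    simp [VectorField.lieBracket]
  exact (congrArg (mfderiv 𝓘(ℝ, E) 𝓘(ℝ, E) (extChartAt 𝓘(ℝ, E) q₀) q₀).inverse
    ((congrFun (VectorField.lieBracketWithin_univ (E := E)) _).trans (h.trans h0))).trans (map_zero _)

/-- The contact condition in a chart. -/
theorem IsContactMetric.chartForm_antisymm {S : AlmostContactMetricStructure E M}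
    (hS : S.IsContactMetric) (q₀ : M) (v w : E) :
    fderiv ℝ (S.chartForm q₀) (extChartAt 𝓘(ℝ, E) q₀ q₀) v w
      - fderiv ℝ (S.chartForm q₀) (extChartAt 𝓘(ℝ, E) q₀ q₀) w v
      = 2 * inner ℝ (chartField q₀ v q₀) (S.φ q₀ (chartField q₀ w q₀)) := by
  have hd := S.differentiableAt_chartForm q₀
  have key : ∀ v w : E, d% (fun q : M ↦ S.η q (chartField q₀ w q)) q₀ (chartField q₀ v q₀)
      = fderiv ℝ (S.chartForm q₀) (extChartAt 𝓘(ℝ, E) q₀ q₀) v w := by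
    intro v w
    have h1 : (fun q : M ↦ S.η q (chartField q₀ w q)) =ᶠ[𝓝 q₀]
        (fun z ↦ S.chartForm q₀ z w) ∘ extChartAt 𝓘(ℝ, E) q₀ := by
      filter_upwards [extChartAt_source_mem_nhds (I := 𝓘(ℝ, E)) q₀] with q hq
      have hz := (extChartAt 𝓘(ℝ, E) q₀).map_source hq
      have hl := (extChartAt 𝓘(ℝ, E) q₀).left_inv hq
      have aux : ∀ q', q' = q → S.η q' (chartField q₀ w q') = S.η q (chartField q₀ w q) := by
        rintro _ rfl; rfl
      simp only [Function.comp, chartForm]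
      rw [mfderiv_extChartAt_symm_eq_symmL hz]
      exact (aux _ hl).symm
    have h2 : HasFDerivAt (fun z ↦ S.chartForm q₀ z w)
        ((fderiv ℝ (S.chartForm q₀) (extChartAt 𝓘(ℝ, E) q₀ q₀)).flip w)
        (extChartAt 𝓘(ℝ, E) q₀ q₀) := by
      have := hd.hasFDerivAt.clm_apply (hasFDerivAt_const w _)
      simpa using this
    have h3 := (h2.hasMFDerivAt.comp q₀
      (mdifferentiableAt_extChartAt (I := 𝓘(ℝ, E)) (mem_chart_source E q₀)).hasMFDerivAt)
    have h4 := (h3.congr_of_eventuallyEq h1).mfderiv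
    have h5 : mfderiv 𝓘(ℝ, E) 𝓘(ℝ, E) (extChartAt 𝓘(ℝ, E) q₀) q₀ (chartField q₀ v q₀) = v := by
      rw [chartField, ← TangentBundle.continuousLinearMapAt_trivializationAt (mem_chart_source E q₀)]
      exact Bundle.Trivialization.continuousLinearMapAt_symmL _
        (FiberBundle.mem_baseSet_trivializationAt' q₀) v
    rw [mvfderiv, h4]
    exact congrArg (fun v ↦ fderiv ℝ (S.chartForm q₀) (extChartAt 𝓘(ℝ, E) q₀ q₀) v w) h5
  have h := hS q₀ _ _ (mdifferentiableAt_chartField q₀ v) (mdifferentiableAt_chartField q₀ w)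
  rw [dη, mlieBracket_chartField, map_zero, key, key] at h
  linarith

/-- Every tangent vector at `q₀` is the value of a coordinate field, so the identity for coordinate
fields holds for all vectors. -/
theorem IsContactMetric.chartForm_antisymm_mfderiv {S : AlmostContactMetricStructure E M}
    (hS : S.IsContactMetric) (q₀ : M) (v w : TangentSpace 𝓘(ℝ, E) q₀) :
    fderiv ℝ (S.chartForm q₀) (extChartAt 𝓘(ℝ, E) q₀ q₀)
        (mfderiv 𝓘(ℝ, E) 𝓘(ℝ, E) (extChartAt 𝓘(ℝ, E) q₀) q₀ v)
        (mfderiv 𝓘(ℝ, E) 𝓘(ℝ, E) (extChartAt 𝓘(ℝ, E) q₀) q₀ w)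
      - fderiv ℝ (S.chartForm q₀) (extChartAt 𝓘(ℝ, E) q₀ q₀)
        (mfderiv 𝓘(ℝ, E) 𝓘(ℝ, E) (extChartAt 𝓘(ℝ, E) q₀) q₀ w)
        (mfderiv 𝓘(ℝ, E) 𝓘(ℝ, E) (extChartAt 𝓘(ℝ, E) q₀) q₀ v)
      = 2 * inner ℝ v (S.φ q₀ w) := by
  have key : ∀ v : TangentSpace 𝓘(ℝ, E) q₀,
      chartField (E := E) q₀ (mfderiv 𝓘(ℝ, E) 𝓘(ℝ, E) (extChartAt 𝓘(ℝ, E) q₀) q₀ v) q₀ = v := by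
    intro v
    have h := Bundle.Trivialization.symmL_continuousLinearMapAt (R := ℝ)
      (trivializationAt E (fun q : M ↦ TangentSpace 𝓘(ℝ, E) q) q₀)
      (FiberBundle.mem_baseSet_trivializationAt' q₀) v
    rw [TangentBundle.continuousLinearMapAt_trivializationAt (mem_chart_source E q₀)] at h
    exact h
  refine (hS.chartForm_antisymm q₀ _ _).trans ?_
  rw [key, key]

theorem chartForm_mfderiv {q₀ q : M} (hq : q ∈ (extChartAt 𝓘(ℝ, E) q₀).source)
    (v : TangentSpace 𝓘(ℝ, E) q) :
    S.chartForm q₀ (extChartAt 𝓘(ℝ, E) q₀ q)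
      (mfderiv 𝓘(ℝ, E) 𝓘(ℝ, E) (extChartAt 𝓘(ℝ, E) q₀) q v) = S.η q v := by
  have hz := (extChartAt 𝓘(ℝ, E) q₀).map_source hq
  have hs : q ∈ (chartAt E q₀).source := by rwa [extChartAt_source] at hq
  have hl := (extChartAt 𝓘(ℝ, E) q₀).left_inv hq
  simp only [chartForm]
  rw [mfderiv_extChartAt_symm_eq_symmL hz]
  have aux : ∀ q', q' = q →
      ∀ w : E, S.η q' ((trivializationAt E (fun q : M ↦ TangentSpace 𝓘(ℝ, E) q) q₀).symmL ℝ q' w) =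
        S.η q ((trivializationAt E (fun q : M ↦ TangentSpace 𝓘(ℝ, E) q) q₀).symmL ℝ q w) := by
    rintro _ rfl _; rfl
  refine (aux _ hl _).trans ?_
  rw [← TangentBundle.continuousLinearMapAt_trivializationAt hs]
  exact congrArg (S.η q) (Bundle.Trivialization.symmL_continuousLinearMapAt _
      (show q ∈ (trivializationAt E (fun q : M ↦ TangentSpace 𝓘(ℝ, E) q) q₀).baseSet from hs) v)

end AlmostContactMetricStructure

end SasakianWarped

/-! ### Pullback of the contact form along a smooth map -/

namespace SasakianWarped

variable {E : Type*} [NormedAddCommGroup E] [NormedSpace ℝ E]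
  {M : Type*} [TopologicalSpace M] [ChartedSpace E M] [IsManifold 𝓘(ℝ, E) ∞ M]
  [Bundle.RiemannianBundle (fun q : M ↦ TangentSpace 𝓘(ℝ, E) q)]
  (S : AlmostContactMetricStructure E M)
  {F : Type*} [NormedAddCommGroup F] [NormedSpace ℝ F]
  {H : Type*} [TopologicalSpace H] {I : ModelWithCorners ℝ F H} [I.Boundaryless]
  {N : Type*} [TopologicalSpace N] [ChartedSpace H N] [IsManifold I ∞ N]

namespace AlmostContactMetricStructure

variable (I) in
/-- The pullback of `η` along `j : N → M`, in the extended chart at `p₀`. -/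
noncomputable def pullbackForm (j : N → M) (p₀ : N) (z : F) : F →L[ℝ] ℝ :=
  (S.η (j ((extChartAt I p₀).symm z))).comp
    ((mfderiv I 𝓘(ℝ, E) j ((extChartAt I p₀).symm z)).comp
      (mfderiv 𝓘(ℝ, F) I (extChartAt I p₀).symm z))

omit [Bundle.RiemannianBundle (fun q : M ↦ TangentSpace 𝓘(ℝ, E) q)] in
theorem eventually_fderiv_chart_eq {j : N → M} (hj : ContMDiff I 𝓘(ℝ, E) ∞ j) (p₀ : N) :
    ∀ᶠ z in 𝓝 (extChartAt I p₀ p₀),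
      j ((extChartAt I p₀).symm z) ∈ (extChartAt 𝓘(ℝ, E) (j p₀)).source ∧
      ∀ h : F, fderiv ℝ (fun z ↦ extChartAt 𝓘(ℝ, E) (j p₀) (j ((extChartAt I p₀).symm z))) z h
        = mfderiv 𝓘(ℝ, E) 𝓘(ℝ, E) (extChartAt 𝓘(ℝ, E) (j p₀)) (j ((extChartAt I p₀).symm z))
          (mfderiv I 𝓘(ℝ, E) j ((extChartAt I p₀).symm z)
            (mfderiv 𝓘(ℝ, F) I (extChartAt I p₀).symm z h)) := by
  have hc : ContinuousAt (fun z ↦ j ((extChartAt I p₀).symm z)) (extChartAt I p₀ p₀) :=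
    hj.continuous.continuousAt.comp (continuousAt_extChartAt_symm p₀)
  have hs : (extChartAt 𝓘(ℝ, E) (j p₀)).source ∈
      𝓝 (j ((extChartAt I p₀).symm (extChartAt I p₀ p₀))) := by
    rw [extChartAt_to_inv]; exact extChartAt_source_mem_nhds _
  filter_upwards [hc.preimage_mem_nhds hs, extChartAt_target_mem_nhds (I := I) p₀] with z hz hz'
  refine ⟨hz, fun h ↦ ?_⟩
  have h1 : MDifferentiableAt 𝓘(ℝ, F) I (extChartAt I p₀).symm z := by
    have := mdifferentiableWithinAt_extChartAt_symm (I := I) hz'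
    rwa [I.range_eq_univ, mdifferentiableWithinAt_univ] at this
  have h2 : MDifferentiableAt I 𝓘(ℝ, E) j ((extChartAt I p₀).symm z) :=
    (hj _).mdifferentiableAt (by simp)
  have h3 : MDifferentiableAt 𝓘(ℝ, E) 𝓘(ℝ, E) (extChartAt 𝓘(ℝ, E) (j p₀))
      (j ((extChartAt I p₀).symm z)) :=
    mdifferentiableAt_extChartAt (by rw [← extChartAt_source 𝓘(ℝ, E)]; exact hz)
  have h4 := (h3.hasMFDerivAt.comp z (h2.hasMFDerivAt.comp z h1.hasMFDerivAt)).mfderiv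
  rw [← mfderiv_eq_fderiv]
  exact congrArg (fun L : F →L[ℝ] E ↦ L h) h4

/-- By the chain rule, this is the pullback of the chart form along the coordinate expression of
`j`, the setting of `fderiv_pullback_antisymm`. -/
theorem pullbackForm_eventuallyEq {j : N → M} (hj : ContMDiff I 𝓘(ℝ, E) ∞ j) (p₀ : N) :
    S.pullbackForm I j p₀ =ᶠ[𝓝 (extChartAt I p₀ p₀)] fun z ↦
      (S.chartForm (j p₀) (extChartAt 𝓘(ℝ, E) (j p₀) (j ((extChartAt I p₀).symm z)))).comp
        (fderiv ℝ (fun z ↦ extChartAt 𝓘(ℝ, E) (j p₀) (j ((extChartAt I p₀).symm z))) z) := by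
  filter_upwards [eventually_fderiv_chart_eq hj p₀] with z ⟨hz, hd⟩
  ext h
  refine Eq.trans ?_ (congrArg (S.chartForm (j p₀)
    (extChartAt 𝓘(ℝ, E) (j p₀) (j ((extChartAt I p₀).symm z)))) (hd h)).symm
  exact (S.chartForm_mfderiv hz _).symm

omit [Bundle.RiemannianBundle (fun q : M ↦ TangentSpace 𝓘(ℝ, E) q)] [IsManifold 𝓘(ℝ, E) ∞ M]
  [IsManifold I ∞ N] in
theorem contDiffAt_chart {j : N → M} (hj : ContMDiff I 𝓘(ℝ, E) ∞ j) (p₀ : N) :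
    ContDiffAt ℝ ∞ (fun z ↦ extChartAt 𝓘(ℝ, E) (j p₀) (j ((extChartAt I p₀).symm z)))
      (extChartAt I p₀ p₀) := by
  have := (contMDiffAt_iff.1 (hj p₀)).2
  rwa [I.range_eq_univ, contDiffWithinAt_univ] at this

theorem differentiableAt_pullbackForm {j : N → M} (hj : ContMDiff I 𝓘(ℝ, E) ∞ j) (p₀ : N) :
    DifferentiableAt ℝ (S.pullbackForm I j p₀) (extChartAt I p₀ p₀) := by
  refine DifferentiableAt.congr_of_eventuallyEq ?_ (S.pullbackForm_eventuallyEq hj p₀)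
  refine (fderiv_pullback_antisymm ((contDiffAt_chart hj p₀).of_le ENat.LEInfty.out) ?_).1
  simpa using S.differentiableAt_chartForm (j p₀)

omit [Bundle.RiemannianBundle (fun q : M ↦ TangentSpace 𝓘(ℝ, E) q)] [IsManifold 𝓘(ℝ, E) ∞ M]
  [IsManifold I ∞ N] in
-- Tangent spaces at `p₀` and `j p₀` are identified with the model spaces through the charts centred
-- there, so no chart derivative appears.
theorem fderiv_chart_self {j : N → M} (hj : ContMDiff I 𝓘(ℝ, E) ∞ j) (p₀ : N)
    (h : TangentSpace I p₀) :
    fderiv ℝ (fun z ↦ extChartAt 𝓘(ℝ, E) (j p₀) (j ((extChartAt I p₀).symm z)))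
      (extChartAt I p₀ p₀) h = mfderiv I 𝓘(ℝ, E) j p₀ h := by
  rw [((hj p₀).mdifferentiableAt (by simp)).mfderiv, I.range_eq_univ, fderivWithin_univ]
  rfl

/-- The exterior derivative of the pullback of the contact form. -/
theorem IsContactMetric.pullbackForm_antisymm {S : AlmostContactMetricStructure E M}
    (hS : S.IsContactMetric) {j : N → M} (hj : ContMDiff I 𝓘(ℝ, E) ∞ j) (p₀ : N)
    (h k : TangentSpace I p₀) :
    fderiv ℝ (S.pullbackForm I j p₀) (extChartAt I p₀ p₀) h k
      - fderiv ℝ (S.pullbackForm I j p₀) (extChartAt I p₀ p₀) k h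
      = 2 * inner ℝ (mfderiv I 𝓘(ℝ, E) j p₀ h) (S.φ (j p₀) (mfderiv I 𝓘(ℝ, E) j p₀ k)) := by
  rw [(S.pullbackForm_eventuallyEq hj p₀).fderiv_eq]
  have hd : DifferentiableAt ℝ (S.chartForm (j p₀)) (extChartAt 𝓘(ℝ, E) (j p₀)
      (j ((extChartAt I p₀).symm (extChartAt I p₀ p₀)))) := by
    simpa using S.differentiableAt_chartForm (j p₀)
  have := (fderiv_pullback_antisymm ((contDiffAt_chart hj p₀).of_le ENat.LEInfty.out)
    hd).2 h k
  have key : ∀ h : TangentSpace I p₀,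
      fderiv ℝ (fun z ↦ extChartAt 𝓘(ℝ, E) (j p₀) (j ((extChartAt I p₀).symm z)))
        (extChartAt I p₀ p₀) h =
      mfderiv 𝓘(ℝ, E) 𝓘(ℝ, E) (extChartAt 𝓘(ℝ, E) (j p₀)) (j p₀) (mfderiv I 𝓘(ℝ, E) j p₀ h) := by
    intro h
    rw [mfderiv_extChartAt_self]
    exact fderiv_chart_self hj p₀ h
  refine this.trans ?_
  rw [extChartAt_to_inv, ← hS.chartForm_antisymm_mfderiv]
  exact congrArg₂ (fun a b : E ↦
    fderiv ℝ (S.chartForm (j p₀)) (extChartAt 𝓘(ℝ, E) (j p₀) (j p₀)) a b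
      - fderiv ℝ (S.chartForm (j p₀)) (extChartAt 𝓘(ℝ, E) (j p₀) (j p₀)) b a) (key h) (key k)

omit [I.Boundaryless] [IsManifold I ∞ N] in
theorem pullbackForm_apply (j : N → M) {p₀ p : N} (hp : p ∈ (extChartAt I p₀).source) (h : F) :
    S.pullbackForm I j p₀ (extChartAt I p₀ p) h =
      S.η (j p) (mfderiv I 𝓘(ℝ, E) j p
        (mfderiv 𝓘(ℝ, F) I (extChartAt I p₀).symm (extChartAt I p₀ p) h)) := by
  have aux : ∀ p', p' = p → ∀ v : F, S.η (j p') (mfderiv I 𝓘(ℝ, E) j p' v) =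
      S.η (j p) (mfderiv I 𝓘(ℝ, E) j p v) := by rintro _ rfl _; rfl
  exact aux _ ((extChartAt I p₀).left_inv hp) _

/-- An integral submanifold of the contact distribution is anti-invariant. -/
theorem IsContactMetric.inner_φ_eq_zero {S : AlmostContactMetricStructure E M}
    (hS : S.IsContactMetric) {j : N → M} (hj : ContMDiff I 𝓘(ℝ, E) ∞ j) (p₀ : N)
    (hη : ∀ᶠ p in 𝓝 p₀, ∀ v, S.η (j p) (mfderiv I 𝓘(ℝ, E) j p v) = 0)
    (h k : TangentSpace I p₀) :
    inner ℝ (mfderiv I 𝓘(ℝ, E) j p₀ h) (S.φ (j p₀) (mfderiv I 𝓘(ℝ, E) j p₀ k)) = 0 := by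
  have h0 : S.pullbackForm I j p₀ =ᶠ[𝓝 (extChartAt I p₀ p₀)] fun _ ↦ 0 := by
    have hc := (continuousAt_extChartAt_symm (I := I) p₀).eventually
      (p := fun p ↦ ∀ v, S.η (j p) (mfderiv I 𝓘(ℝ, E) j p v) = 0) (by rwa [extChartAt_to_inv])
    filter_upwards [hc] with z hz
    ext v
    exact hz _
  have := hS.pullbackForm_antisymm hj p₀ h k
  rw [h0.fderiv_eq] at this
  have h2 : 2 * inner ℝ (mfderiv I 𝓘(ℝ, E) j p₀ h) (S.φ (j p₀) (mfderiv I 𝓘(ℝ, E) j p₀ k))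
      = (0 : ℝ) - 0 := by
    rw [← this, fderiv_const_apply]; rfl
  linarith

end AlmostContactMetricStructure

end SasakianWarped

/-! ### Tangent vectors and `η` on a warped product -/

namespace SasakianWarped

section WarpedGeometry

variable {E : Type*} [NormedAddCommGroup E] [NormedSpace ℝ E] [FiniteDimensional ℝ E]
  {M : Type*} [TopologicalSpace M] [ChartedSpace E M] [IsManifold 𝓘(ℝ, E) ∞ M]
  [Bundle.RiemannianBundle (fun q : M ↦ TangentSpace 𝓘(ℝ, E) q)]
  {E₁ : Type*} [NormedAddCommGroup E₁] [NormedSpace ℝ E₁]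
  {MT : Type*} [TopologicalSpace MT] [ChartedSpace E₁ MT] [IsManifold 𝓘(ℝ, E₁) ∞ MT]
  [Bundle.RiemannianBundle (fun p : MT ↦ TangentSpace 𝓘(ℝ, E₁) p)]
  {E₂ : Type*} [NormedAddCommGroup E₂] [NormedSpace ℝ E₂]
  {Mθ : Type*} [TopologicalSpace Mθ] [ChartedSpace E₂ Mθ] [IsManifold 𝓘(ℝ, E₂) ∞ Mθ]
  [Bundle.RiemannianBundle (fun p : Mθ ↦ TangentSpace 𝓘(ℝ, E₂) p)]
  {f : MT → ℝ} {ι : MT × Mθ → M}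
  {S : AlmostContactMetricStructure E M}

theorem warpedMetric_apply (f : MT → ℝ) (p : MT × Mθ) (h h' : TangentSpace 𝓘(ℝ, E₁) p.1)
    (k k' : TangentSpace 𝓘(ℝ, E₂) p.2) :
    warpedMetric E₁ E₂ f p ((h, k) : E₁ × E₂) ((h', k') : E₁ × E₂) =
      inner ℝ h h' + f p.1 ^ 2 * inner ℝ k k' := by
  have key : ∀ X Y : TangentSpace (𝓘(ℝ, E₁).prod 𝓘(ℝ, E₂)) p, warpedMetric E₁ E₂ f p X Y =
      inner ℝ (ContinuousLinearMap.fst ℝ (TangentSpace 𝓘(ℝ, E₁) p.1) (TangentSpace 𝓘(ℝ, E₂) p.2) X)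
        (ContinuousLinearMap.fst ℝ (TangentSpace 𝓘(ℝ, E₁) p.1) (TangentSpace 𝓘(ℝ, E₂) p.2) Y)
      + f p.1 ^ 2 * inner ℝ
        (ContinuousLinearMap.snd ℝ (TangentSpace 𝓘(ℝ, E₁) p.1) (TangentSpace 𝓘(ℝ, E₂) p.2) X)
        (ContinuousLinearMap.snd ℝ (TangentSpace 𝓘(ℝ, E₁) p.1) (TangentSpace 𝓘(ℝ, E₂) p.2) Y) := by
    intro X Y
    rw [warpedMetric, mfderiv_fst, mfderiv_snd]
    rfl
  exact key _ _

omit [Bundle.RiemannianBundle (fun p : MT ↦ TangentSpace 𝓘(ℝ, E₁) p)]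
  [Bundle.RiemannianBundle (fun p : Mθ ↦ TangentSpace 𝓘(ℝ, E₂) p)] in
theorem mfderiv_extChartAt_symm_prod {p₀ : MT × Mθ} {z : E₁ × E₂}
    (hz : z ∈ (extChartAt (𝓘(ℝ, E₁).prod 𝓘(ℝ, E₂)) p₀).target) (h : E₁) (k : E₂) :
    mfderiv 𝓘(ℝ, E₁ × E₂) (𝓘(ℝ, E₁).prod 𝓘(ℝ, E₂))
        (extChartAt (𝓘(ℝ, E₁).prod 𝓘(ℝ, E₂)) p₀).symm z (h, k) =
      ((mfderiv 𝓘(ℝ, E₁) 𝓘(ℝ, E₁) (extChartAt 𝓘(ℝ, E₁) p₀.1).symm z.1 h,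
        mfderiv 𝓘(ℝ, E₂) 𝓘(ℝ, E₂) (extChartAt 𝓘(ℝ, E₂) p₀.2).symm z.2 k) : E₁ × E₂) := by
  have e : (extChartAt (𝓘(ℝ, E₁).prod 𝓘(ℝ, E₂)) p₀).symm = fun z : E₁ × E₂ ↦
      ((extChartAt 𝓘(ℝ, E₁) p₀.1).symm z.1, (extChartAt 𝓘(ℝ, E₂) p₀.2).symm z.2) := by
    rw [extChartAt_prod]; rfl
  rw [extChartAt_prod] at hz
  have h1 : MDifferentiableAt 𝓘(ℝ, E₁) 𝓘(ℝ, E₁) (extChartAt 𝓘(ℝ, E₁) p₀.1).symm z.1 := by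
    have := mdifferentiableWithinAt_extChartAt_symm (I := 𝓘(ℝ, E₁)) hz.1
    rwa [ModelWithCorners.range_eq_univ, mdifferentiableWithinAt_univ] at this
  have h2 : MDifferentiableAt 𝓘(ℝ, E₂) 𝓘(ℝ, E₂) (extChartAt 𝓘(ℝ, E₂) p₀.2).symm z.2 := by
    have := mdifferentiableWithinAt_extChartAt_symm (I := 𝓘(ℝ, E₂)) hz.2
    rwa [ModelWithCorners.range_eq_univ, mdifferentiableWithinAt_univ] at this
  have h3 := (h1.hasMFDerivAt.comp z
    (hasFDerivAt_fst (𝕜 := ℝ) (E := E₁) (F := E₂) (p := z)).hasMFDerivAt).prodMk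
    (h2.hasMFDerivAt.comp z (hasFDerivAt_snd (𝕜 := ℝ) (E := E₁) (F := E₂) (p := z)).hasMFDerivAt)
  have h4 := h3.mfderiv
  rw [e]
  exact congrArg (fun L : E₁ × E₂ →L[ℝ] E₁ × E₂ ↦ L (h, k)) h4

theorem mfderiv_extChartAt_symm_self {F : Type*} [NormedAddCommGroup F] [NormedSpace ℝ F]
    {N : Type*} [TopologicalSpace N] [ChartedSpace F N] [IsManifold 𝓘(ℝ, F) ∞ N] (x : N) (v : F) :
    mfderiv 𝓘(ℝ, F) 𝓘(ℝ, F) (extChartAt 𝓘(ℝ, F) x).symm (extChartAt 𝓘(ℝ, F) x x) v = v := by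
  have := mfderivWithin_range_extChartAt_symm (I := 𝓘(ℝ, F)) (x := x)
  rw [ModelWithCorners.range_eq_univ, mfderivWithin_univ] at this
  exact congrArg (fun L : F →L[ℝ] F ↦ L v) this

namespace IsWarpedProductSubmanifold

variable (hι : IsWarpedProductSubmanifold E E₁ E₂ f ι)
include hι

theorem mfderiv_left (x : MT) (y : Mθ) (h : TangentSpace 𝓘(ℝ, E₁) x) :
    mfderiv 𝓘(ℝ, E₁) 𝓘(ℝ, E) (fun x : MT ↦ ι (x, y)) x h =
      mfderiv (𝓘(ℝ, E₁).prod 𝓘(ℝ, E₂)) 𝓘(ℝ, E) ι (x, y) ((h, 0) : E₁ × E₂) := by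
  have h1 : MDifferentiableAt (𝓘(ℝ, E₁).prod 𝓘(ℝ, E₂)) 𝓘(ℝ, E) ι (x, y) :=
    (hι.smooth_ι _).mdifferentiableAt (by simp)
  have h2 : MDifferentiableAt 𝓘(ℝ, E₁) (𝓘(ℝ, E₁).prod 𝓘(ℝ, E₂)) (fun x : MT ↦ (x, y)) x :=
    mdifferentiableAt_id.prodMk mdifferentiableAt_const
  have h3 := mfderiv_comp x h1 h2
  rw [mfderiv_prod_left] at h3
  exact congrArg (fun L : E₁ →L[ℝ] E ↦ L h) h3

theorem mfderiv_right (x : MT) (y : Mθ) (k : TangentSpace 𝓘(ℝ, E₂) y) :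
    mfderiv 𝓘(ℝ, E₂) 𝓘(ℝ, E) (fun y : Mθ ↦ ι (x, y)) y k =
      mfderiv (𝓘(ℝ, E₁).prod 𝓘(ℝ, E₂)) 𝓘(ℝ, E) ι (x, y) ((0, k) : E₁ × E₂) := by
  have h1 : MDifferentiableAt (𝓘(ℝ, E₁).prod 𝓘(ℝ, E₂)) 𝓘(ℝ, E) ι (x, y) :=
    (hι.smooth_ι _).mdifferentiableAt (by simp)
  have h2 : MDifferentiableAt 𝓘(ℝ, E₂) (𝓘(ℝ, E₁).prod 𝓘(ℝ, E₂)) (fun y : Mθ ↦ (x, y)) y :=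
    mdifferentiableAt_const.prodMk mdifferentiableAt_id
  have h3 := mfderiv_comp y h1 h2
  rw [mfderiv_prod_right] at h3
  exact congrArg (fun L : E₂ →L[ℝ] E ↦ L k) h3

theorem mfderiv_add (p : MT × Mθ) (h : E₁) (k : E₂) :
    mfderiv (𝓘(ℝ, E₁).prod 𝓘(ℝ, E₂)) 𝓘(ℝ, E) ι p ((h, k) : E₁ × E₂) =
      mfderiv 𝓘(ℝ, E₁) 𝓘(ℝ, E) (fun x : MT ↦ ι (x, p.2)) p.1 h +
      mfderiv 𝓘(ℝ, E₂) 𝓘(ℝ, E) (fun y : Mθ ↦ ι (p.1, y)) p.2 k := by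
  refine Eq.trans ?_ (congrArg₂ (· + ·) (hι.mfderiv_left p.1 p.2 h)
    (hι.mfderiv_right p.1 p.2 k)).symm
  refine Eq.trans ?_ (map_add (mfderiv (𝓘(ℝ, E₁).prod 𝓘(ℝ, E₂)) 𝓘(ℝ, E) ι p) _ _)
  congr 1
  exact (Prod.mk_add_mk h 0 0 k |>.trans (by simp)).symm

theorem inner_left_right (p : MT × Mθ) (h : TangentSpace 𝓘(ℝ, E₁) p.1)
    (k : TangentSpace 𝓘(ℝ, E₂) p.2) :
    inner ℝ (mfderiv 𝓘(ℝ, E₁) 𝓘(ℝ, E) (fun x : MT ↦ ι (x, p.2)) p.1 h)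
      (mfderiv 𝓘(ℝ, E₂) 𝓘(ℝ, E) (fun y : Mθ ↦ ι (p.1, y)) p.2 k) = (0 : ℝ) := by
  have e := hι.isometric p ((h, 0) : E₁ × E₂) ((0, k) : E₁ × E₂)
  rw [hι.mfderiv_left, hι.mfderiv_right]
  refine e.trans ((warpedMetric_apply ..).trans ?_)
  have h1 : inner ℝ h (0 : TangentSpace 𝓘(ℝ, E₁) p.1) = (0 : ℝ) := inner_zero_right _
  have h2 : inner ℝ (0 : TangentSpace 𝓘(ℝ, E₂) p.2) k = (0 : ℝ) := inner_zero_left _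
  refine (congrArg₂ (fun a b : ℝ ↦ a + f p.1 ^ 2 * b) h1 h2).trans (by simp)

theorem inner_right_right (p : MT × Mθ) (k l : TangentSpace 𝓘(ℝ, E₂) p.2) :
    inner ℝ (mfderiv 𝓘(ℝ, E₂) 𝓘(ℝ, E) (fun y : Mθ ↦ ι (p.1, y)) p.2 k)
      (mfderiv 𝓘(ℝ, E₂) 𝓘(ℝ, E) (fun y : Mθ ↦ ι (p.1, y)) p.2 l) = f p.1 ^ 2 * inner ℝ k l := by
  have e := hι.isometric p ((0, k) : E₁ × E₂) ((0, l) : E₁ × E₂)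
  rw [hι.mfderiv_right, hι.mfderiv_right]
  refine e.trans ((warpedMetric_apply ..).trans ?_)
  have h1 : inner ℝ (0 : TangentSpace 𝓘(ℝ, E₁) p.1) (0 : TangentSpace 𝓘(ℝ, E₁) p.1) = (0 : ℝ) :=
    inner_zero_right _
  refine (congrArg (fun a : ℝ ↦ a + f p.1 ^ 2 * inner ℝ k l) h1).trans (by simp)

/-- The pullback of `η` in the product chart. -/
theorem pullbackForm_apply_mk (p₀ : MT × Mθ) {p : MT × Mθ}
    (hp : p ∈ (extChartAt (𝓘(ℝ, E₁).prod 𝓘(ℝ, E₂)) p₀).source) (h : E₁) (k : E₂) :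
    S.pullbackForm (𝓘(ℝ, E₁).prod 𝓘(ℝ, E₂)) ι p₀ (extChartAt (𝓘(ℝ, E₁).prod 𝓘(ℝ, E₂)) p₀ p) (h, k)
      = S.η (ι p) (mfderiv 𝓘(ℝ, E₁) 𝓘(ℝ, E) (fun x : MT ↦ ι (x, p.2)) p.1
          (mfderiv 𝓘(ℝ, E₁) 𝓘(ℝ, E₁) (extChartAt 𝓘(ℝ, E₁) p₀.1).symm
            (extChartAt 𝓘(ℝ, E₁) p₀.1 p.1) h))
        + S.η (ι p) (mfderiv 𝓘(ℝ, E₂) 𝓘(ℝ, E) (fun y : Mθ ↦ ι (p.1, y)) p.2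
          (mfderiv 𝓘(ℝ, E₂) 𝓘(ℝ, E₂) (extChartAt 𝓘(ℝ, E₂) p₀.2).symm
            (extChartAt 𝓘(ℝ, E₂) p₀.2 p.2) k)) := by
  refine (S.pullbackForm_apply ι hp (h, k)).trans ?_
  refine (congrArg (fun v : E₁ × E₂ ↦
    S.η (ι p) (mfderiv (𝓘(ℝ, E₁).prod 𝓘(ℝ, E₂)) 𝓘(ℝ, E) ι p v)) (mfderiv_extChartAt_symm_prod
    ((extChartAt (𝓘(ℝ, E₁).prod 𝓘(ℝ, E₂)) p₀).map_source hp) h k)).trans ?_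
  refine (congrArg (S.η (ι p)) (hι.mfderiv_add p _ _)).trans ?_
  rw [extChartAt_prod]
  exact map_add _ _ _

theorem pullbackForm_apply_left (p₀ : MT × Mθ) {p : MT × Mθ}
    (hp : p ∈ (extChartAt (𝓘(ℝ, E₁).prod 𝓘(ℝ, E₂)) p₀).source) (h : E₁) :
    S.pullbackForm (𝓘(ℝ, E₁).prod 𝓘(ℝ, E₂)) ι p₀ (extChartAt (𝓘(ℝ, E₁).prod 𝓘(ℝ, E₂)) p₀ p)
      ((h, 0) : E₁ × E₂)
      = S.η (ι p) (mfderiv 𝓘(ℝ, E₁) 𝓘(ℝ, E) (fun x : MT ↦ ι (x, p.2)) p.1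
          (mfderiv 𝓘(ℝ, E₁) 𝓘(ℝ, E₁) (extChartAt 𝓘(ℝ, E₁) p₀.1).symm
            (extChartAt 𝓘(ℝ, E₁) p₀.1 p.1) h)) := by
  refine (hι.pullbackForm_apply_mk p₀ hp h 0).trans (add_eq_left.2 ?_)
  refine (congrArg (S.η (ι p)) ((congrArg (mfderiv 𝓘(ℝ, E₂) 𝓘(ℝ, E) (fun y : Mθ ↦ ι (p.1, y)) p.2)
    (map_zero _)).trans (map_zero _))).trans (map_zero _)

theorem pullbackForm_apply_right (p₀ : MT × Mθ) {p : MT × Mθ}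
    (hp : p ∈ (extChartAt (𝓘(ℝ, E₁).prod 𝓘(ℝ, E₂)) p₀).source) (k : E₂) :
    S.pullbackForm (𝓘(ℝ, E₁).prod 𝓘(ℝ, E₂)) ι p₀ (extChartAt (𝓘(ℝ, E₁).prod 𝓘(ℝ, E₂)) p₀ p)
      ((0, k) : E₁ × E₂)
      = S.η (ι p) (mfderiv 𝓘(ℝ, E₂) 𝓘(ℝ, E) (fun y : Mθ ↦ ι (p.1, y)) p.2
          (mfderiv 𝓘(ℝ, E₂) 𝓘(ℝ, E₂) (extChartAt 𝓘(ℝ, E₂) p₀.2).symm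
            (extChartAt 𝓘(ℝ, E₂) p₀.2 p.2) k)) := by
  refine (hι.pullbackForm_apply_mk p₀ hp 0 k).trans (add_eq_right.2 ?_)
  refine (congrArg (S.η (ι p)) ((congrArg (mfderiv 𝓘(ℝ, E₁) 𝓘(ℝ, E) (fun x : MT ↦ ι (x, p.2)) p.1)
    (map_zero _)).trans (map_zero _))).trans (map_zero _)

end IsWarpedProductSubmanifold

/-! ### Position of `ξ` relative to the leaves, and its effect on `f` -/

namespace IsWarpedProductPointwiseSemiSlant

variable (hι : IsWarpedProductPointwiseSemiSlant E₁ E₂ S f ι)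
include hι

/-- Where `η` does not vanish on the invariant leaf, `ξ` is tangent to it. -/
theorem ξ_mem_left {p : MT × Mθ} {h : TangentSpace 𝓘(ℝ, E₁) p.1}
    (hh : S.η (ι p) (mfderiv 𝓘(ℝ, E₁) 𝓘(ℝ, E) (fun x : MT ↦ ι (x, p.2)) p.1 h) ≠ 0) :
    S.ξ (ι p) ∈ tangentRange E 𝓘(ℝ, E₁) (fun x : MT ↦ ι (x, p.2)) p.1 :=
  S.ξ_mem_of_invariant (hι.invariant p.2 p.1) ⟨h, rfl⟩ hh

/-- Where `ξ` is tangent to the invariant leaf, `η` vanishes on the slant leaf. -/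
theorem η_right_eq_zero {p : MT × Mθ}
    (hξ : S.ξ (ι p) ∈ tangentRange E 𝓘(ℝ, E₁) (fun x : MT ↦ ι (x, p.2)) p.1)
    (k : TangentSpace 𝓘(ℝ, E₂) p.2) :
    S.η (ι p) (mfderiv 𝓘(ℝ, E₂) 𝓘(ℝ, E) (fun y : Mθ ↦ ι (p.1, y)) p.2 k) = 0 := by
  obtain ⟨h, hh⟩ := hξ
  have e := hι.warped.inner_left_right p h k
  rw [real_inner_comm] at e
  rw [← S.inner_ξ, ← hh]
  exact e

/-- Where `η` vanishes on the invariant leaf, `ξ` is tangent to the slant leaf. -/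
theorem ξ_mem_right {p : MT × Mθ}
    (hh : ∀ h, S.η (ι p) (mfderiv 𝓘(ℝ, E₁) 𝓘(ℝ, E) (fun x : MT ↦ ι (x, p.2)) p.1 h) = 0) :
    S.ξ (ι p) ∈ tangentRange E 𝓘(ℝ, E₂) (fun y : Mθ ↦ ι (p.1, y)) p.2 := by
  obtain ⟨⟨h, k⟩, hk⟩ := hι.reeb_tangent p
  have hk' := (hι.warped.mfderiv_add p h k).symm.trans hk
  set a := mfderiv 𝓘(ℝ, E₁) 𝓘(ℝ, E) (fun x : MT ↦ ι (x, p.2)) p.1 h with ha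
  -- The `MT` component `a` of `ξ` is orthogonal both to `ξ` and to the `Mθ` component, hence to
  -- itself.
  have h0 : inner ℝ a a = (0 : ℝ) := by
    have h1 : inner ℝ a (S.ξ (ι p)) = (0 : ℝ) := by rw [S.inner_ξ]; exact hh h
    rw [← hk'] at h1
    have h2 := hι.warped.inner_left_right p h k
    exact ((inner_add_right a a _).symm.trans h1 |> fun e ↦ by rw [h2, add_zero] at e; exact e)
  have h1 : a = 0 := inner_self_eq_zero.1 h0
  rw [h1, zero_add] at hk'
  exact ⟨k, hk'⟩

/-- A vector with `η ≠ 0` is extended with constant coordinates in the product chart; continuity of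
the pullback form at `p₀` keeps the value nonzero nearby. -/
theorem isOpen_setOf_η_left : IsOpen {p : MT × Mθ | ∃ h,
    S.η (ι p) (mfderiv 𝓘(ℝ, E₁) 𝓘(ℝ, E) (fun x : MT ↦ ι (x, p.2)) p.1 h) ≠ 0} := by
  refine isOpen_iff_mem_nhds.2 ?_
  rintro p₀ ⟨h, hh⟩
  have hc := ((S.differentiableAt_pullbackForm hι.warped.smooth_ι p₀).continuousAt.comp
    (continuousAt_extChartAt p₀)).clm_apply (continuousAt_const (y := ((h, 0) : E₁ × E₂)))
  have h0 := (hι.warped.pullbackForm_apply_left (S := S) p₀ (mem_extChartAt_source p₀) h).trans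
    (congrArg (fun v : E₁ ↦ S.η (ι p₀) (mfderiv 𝓘(ℝ, E₁) 𝓘(ℝ, E) (fun x : MT ↦ ι (x, p₀.2)) p₀.1 v))
      (mfderiv_extChartAt_symm_self (F := E₁) p₀.1 h))
  have hn := hc.eventually_ne (show _ ≠ (0 : ℝ) from fun e ↦ hh (h0.symm.trans e))
  filter_upwards [hn, extChartAt_source_mem_nhds (I := 𝓘(ℝ, E₁).prod 𝓘(ℝ, E₂)) p₀] with p hp hs
  exact ⟨_, fun e ↦ hp ((hι.warped.pullbackForm_apply_left (S := S) p₀ hs h).trans e)⟩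

theorem isOpen_setOf_η_right : IsOpen {p : MT × Mθ | ∃ k,
    S.η (ι p) (mfderiv 𝓘(ℝ, E₂) 𝓘(ℝ, E) (fun y : Mθ ↦ ι (p.1, y)) p.2 k) ≠ 0} := by
  refine isOpen_iff_mem_nhds.2 ?_
  rintro p₀ ⟨k, hk⟩
  have hc := ((S.differentiableAt_pullbackForm hι.warped.smooth_ι p₀).continuousAt.comp
    (continuousAt_extChartAt p₀)).clm_apply (continuousAt_const (y := ((0, k) : E₁ × E₂)))
  have h0 := (hι.warped.pullbackForm_apply_right (S := S) p₀ (mem_extChartAt_source p₀) k).trans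
    (congrArg (fun v : E₂ ↦ S.η (ι p₀) (mfderiv 𝓘(ℝ, E₂) 𝓘(ℝ, E) (fun y : Mθ ↦ ι (p₀.1, y)) p₀.2 v))
      (mfderiv_extChartAt_symm_self (F := E₂) p₀.2 k))
  have hn := hc.eventually_ne (show _ ≠ (0 : ℝ) from fun e ↦ hk (h0.symm.trans e))
  filter_upwards [hn, extChartAt_source_mem_nhds (I := 𝓘(ℝ, E₁).prod 𝓘(ℝ, E₂)) p₀] with p hp hs
  exact ⟨_, fun e ↦ hp ((hι.warped.pullbackForm_apply_right (S := S) p₀ hs k).trans e)⟩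

/-- The set where `ξ` is tangent to the invariant leaves is open and closed. -/
theorem isClopen_setOf_reeb_left : IsClopen {p : MT × Mθ |
    S.ξ (ι p) ∈ tangentRange E 𝓘(ℝ, E₁) (fun x : MT ↦ ι (x, p.2)) p.1} := by
  constructor
  · rw [← isOpen_compl_iff]
    -- The complement consists of the points where `η` is nonzero on the slant leaf: there `ξ` is
    -- itself tangent to that leaf, and `η(ξ) = 1`.
    convert hι.isOpen_setOf_η_right using 1
    ext p
    constructor
    · intro hp
      obtain ⟨k, hk⟩ := hι.ξ_mem_right (p := p) fun h ↦ by
        by_contra hh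
        exact hp (hι.ξ_mem_left hh)
      refine ⟨k, fun e ↦ one_ne_zero (α := ℝ) ?_⟩
      rw [← S.η_ξ (ι p), ← hk]
      exact e
    · rintro ⟨k, hk⟩ hp
      exact hk (hι.η_right_eq_zero hp k)
  · convert hι.isOpen_setOf_η_left using 1
    ext p
    constructor
    · rintro ⟨h, hh⟩
      refine ⟨h, fun e ↦ one_ne_zero (α := ℝ) ?_⟩
      rw [← S.η_ξ (ι p), ← hh]
      exact e
    · rintro ⟨h, hh⟩
      exact hι.ξ_mem_left hh

/-- Near the points where `ξ` is tangent to the slant leaves, the warping function is stationary: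
by the Cauchy–Schwarz inequality `η(k)² ≤ f² |k|²` along the invariant leaf, with equality for
`k = ξ`, and the derivative of `η(k)` vanishes there since `φ ξ = 0`. -/
theorem mfderiv_f_eq_zero (hS : S.IsContactMetric) (p₀ : MT × Mθ)
    (hp : ∀ᶠ p in 𝓝 p₀, ∀ h,
      S.η (ι p) (mfderiv 𝓘(ℝ, E₁) 𝓘(ℝ, E) (fun x : MT ↦ ι (x, p.2)) p.1 h) = 0) :
    mfderiv 𝓘(ℝ, E₁) 𝓘(ℝ, ℝ) f p₀.1 = 0 := by
  obtain ⟨k, hk⟩ := hι.ξ_mem_right hp.self_of_nhds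
  have hk1 : mfderiv 𝓘(ℝ, E₂) 𝓘(ℝ, E) (fun y : Mθ ↦ ι (p₀.1, y)) p₀.2 k = S.ξ (ι p₀) := hk
  set β := S.pullbackForm (𝓘(ℝ, E₁).prod 𝓘(ℝ, E₂)) ι p₀ with hβ
  set e := extChartAt (𝓘(ℝ, E₁).prod 𝓘(ℝ, E₂)) p₀ with he
  set e₁ := extChartAt 𝓘(ℝ, E₁) p₀.1 with he₁
  set e₂ := extChartAt 𝓘(ℝ, E₂) p₀.2 with he₂
  have hep : ∀ p : MT × Mθ, e p = (e₁ p.1, e₂ p.2) := by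
    intro p; rw [he, extChartAt_prod]; rfl
  have hβd : DifferentiableAt ℝ β (e p₀) := S.differentiableAt_pullbackForm hι.warped.smooth_ι p₀
  -- `β` vanishes on the tangent vectors of the invariant leaves
  have hleft : ∀ h : E₁, (fun z ↦ β z (h, 0)) =ᶠ[𝓝 (e p₀)] fun _ ↦ 0 := by
    intro h
    have hc := (continuousAt_extChartAt_symm (I := 𝓘(ℝ, E₁).prod 𝓘(ℝ, E₂)) p₀).eventually
      (p := fun p ↦ ∀ h,
      S.η (ι p) (mfderiv 𝓘(ℝ, E₁) 𝓘(ℝ, E) (fun x : MT ↦ ι (x, p.2)) p.1 h) = 0)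
      (by rwa [extChartAt_to_inv])
    filter_upwards [hc, extChartAt_target_mem_nhds (I := 𝓘(ℝ, E₁).prod 𝓘(ℝ, E₂)) p₀] with z hz ht
    have h1 := (hι.warped.pullbackForm_apply_left (S := S) p₀ (e.map_target ht) h).trans (hz _)
    rw [← he, e.right_inv ht] at h1
    exact h1
  -- The antisymmetrised derivative is `2g(h, φξ) = 0`, and its second term differentiates `β(h,
  -- 0)`, which is zero near the point.
  have hanti : ∀ h : E₁, fderiv ℝ β (e p₀) (h, 0) (0, k) = 0 := by
    intro h
    have h1 := hS.pullbackForm_antisymm hι.warped.smooth_ι p₀ ((h, 0) : E₁ × E₂) ((0, k) : E₁ × E₂)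
    have h2 : mfderiv (𝓘(ℝ, E₁).prod 𝓘(ℝ, E₂)) 𝓘(ℝ, E) ι p₀ ((0, k) : E₁ × E₂) = S.ξ (ι p₀) :=
      (hι.warped.mfderiv_right p₀.1 p₀.2 k).symm.trans hk
    rw [h2, S.φ_ξ, inner_zero_right, mul_zero] at h1
    have h3 : fderiv ℝ β (e p₀) (0, k) (h, 0) = 0 := by
      have h4 := (hβd.hasFDerivAt.clm_apply (hasFDerivAt_const ((h, 0) : E₁ × E₂) (e p₀))).fderiv
      rw [(hleft h).fderiv_eq, fderiv_const_apply] at h4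
      have h5 := congrArg (fun L : E₁ × E₂ →L[ℝ] ℝ ↦ L (0, k)) h4
      simpa using h5.symm
    have h6 : fderiv ℝ β (e p₀) (h, 0) (0, k) - fderiv ℝ β (e p₀) (0, k) (h, 0) = 0 := h1
    linarith
  set c : ℝ := inner ℝ k k with hc
  have hβv : ∀ x, x ∈ e₁.source → β (e₁ x, e₂ p₀.2) (0, k) =
      S.η (ι (x, p₀.2)) (mfderiv 𝓘(ℝ, E₂) 𝓘(ℝ, E) (fun y : Mθ ↦ ι (x, y)) p₀.2 k) := by
    intro x hx
    have hs : (x, p₀.2) ∈ e.source := by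
      rw [he, extChartAt_prod]; exact ⟨hx, mem_extChartAt_source _⟩
    have h1 := (hι.warped.pullbackForm_apply_right (S := S) p₀ hs k).trans
      (congrArg (fun v : E₂ ↦ S.η (ι (x, p₀.2))
        (mfderiv 𝓘(ℝ, E₂) 𝓘(ℝ, E) (fun y : Mθ ↦ ι (x, y)) p₀.2 v))
        (mfderiv_extChartAt_symm_self (F := E₂) p₀.2 k))
    rw [← he, hep] at h1
    exact h1
  have hβ1 : β (e₁ p₀.1, e₂ p₀.2) (0, k) = 1 := by
    rw [hβv _ (mem_extChartAt_source _)]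
    exact (congrArg (S.η (ι p₀)) hk1).trans (S.η_ξ _)
  have hc1 : f p₀.1 ^ 2 * c = 1 := by
    rw [hc, ← hι.warped.inner_right_right, hk1, S.inner_ξ_ξ]
  -- The vector `k` stays fixed while the point moves in `MT`, so its squared length in `M` is
  -- `f²c`. Thus `ψ` is the Cauchy–Schwarz defect of `k`, zero at the centre.
  set ψ : E₁ → ℝ := fun a ↦ f (e₁.symm a) ^ 2 * c - β (a, e₂ p₀.2) (0, k) ^ 2 with hψ
  have hmin : IsLocalMin ψ (e₁ p₀.1) := by
    filter_upwards [extChartAt_target_mem_nhds (I := 𝓘(ℝ, E₁)) p₀.1] with a ha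
    have h0 : ψ (e₁ p₀.1) = 0 := by
      simp only [hψ]
      rw [hβ1, he₁, extChartAt_to_inv, hc1]
      norm_num
    rw [h0]
    have h1 := hβv _ (e₁.map_target ha)
    rw [e₁.right_inv ha] at h1
    simp only [hψ]
    rw [h1, hc, ← hι.warped.inner_right_right (e₁.symm a, p₀.2), sub_nonneg]
    exact S.sq_η_le _ _
  obtain ⟨D, hD⟩ : ∃ D : E₁ →L[ℝ] ℝ, D = mfderiv 𝓘(ℝ, E₁) 𝓘(ℝ, ℝ) f p₀.1 := ⟨_, rfl⟩
  have hfd : HasFDerivAt (fun a ↦ f (e₁.symm a)) D (e₁ p₀.1) := by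
    have h1 := ((hι.warped.smooth_f p₀.1).mdifferentiableAt (by simp)).hasMFDerivAt.2
    rw [ModelWithCorners.range_eq_univ, ← hD] at h1
    exact HasFDerivWithinAt.hasFDerivAt (E := E₁) (F := ℝ) h1 Filter.univ_mem
  have hpair : HasFDerivAt (fun a : E₁ ↦ (a, e₂ p₀.2)) (ContinuousLinearMap.inl ℝ E₁ E₂) (e₁ p₀.1) :=
    hasFDerivAt_prodMk_left _ _
  have hβd' : HasFDerivAt β (fderiv ℝ β (e p₀)) (e₁ p₀.1, e₂ p₀.2) := by
    rw [← hep]; exact hβd.hasFDerivAt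
  have hβa : HasFDerivAt (fun a : E₁ ↦ β (a, e₂ p₀.2) (0, k)) (0 : E₁ →L[ℝ] ℝ) (e₁ p₀.1) := by
    have h1 := (hβd'.comp (e₁ p₀.1) hpair).clm_apply
      (hasFDerivAt_const ((0, k) : E₁ × E₂) (e₁ p₀.1))
    refine h1.congr_fderiv ?_
    ext h
    simpa using hanti h
  -- The second square has zero derivative, so stationarity of `ψ` reads `2 f c · D = 0`, with `f`
  -- and `c` nonzero.
  have hψd := ((hfd.pow 2).mul_const c).sub (hβa.pow 2)
  have h0 := hmin.hasFDerivAt_eq_zero hψd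
  have hf0 : f p₀.1 ≠ 0 := (hι.warped.pos_f _).ne'
  have hc0 : c ≠ 0 := fun h ↦ by rw [h, mul_zero] at hc1; exact zero_ne_one hc1
  have hto : e₁.symm (e₁ p₀.1) = p₀.1 := extChartAt_to_inv _
  refine hD.symm.trans ?_
  ext h
  have h2 := congrArg (fun L : E₁ →L[ℝ] ℝ ↦ L h) h0
  have h3 : D h = 0 := by simpa [hto, hf0, hc0] using h2
  exact h3

/-- If `ξ` is tangent to the invariant leaves, then the other leaves are anti-invariant. -/
theorem isAntiInvariant_right (hS : S.IsContactMetric)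
    (h : ∀ p : MT × Mθ, S.ξ (ι p) ∈ tangentRange E 𝓘(ℝ, E₁) (fun x : MT ↦ ι (x, p.2)) p.1) (x : MT) :
    IsAntiInvariant 𝓘(ℝ, E₂) S (fun y : Mθ ↦ ι (x, y)) := by
  rintro y _ ⟨k, rfl⟩ _ ⟨l, rfl⟩
  rw [real_inner_comm]
  refine hS.inner_φ_eq_zero (j := fun y : Mθ ↦ ι (x, y)) ?_ y ?_ l k
  · exact hι.warped.smooth_ι.comp (contMDiff_const.prodMk contMDiff_id)
  · exact Filter.Eventually.of_forall fun y' k' ↦ hι.η_right_eq_zero (h (x, y')) k'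

end IsWarpedProductPointwiseSemiSlant

/-- In a chart, `g` has zero derivative on a ball, which is convex, so `g` is locally constant;
preconnectedness makes it constant. -/
theorem eq_of_mfderiv_eq_zero {F : Type*} [NormedAddCommGroup F] [NormedSpace ℝ F]
    {N : Type*} [TopologicalSpace N] [ChartedSpace F N] [IsManifold 𝓘(ℝ, F) ∞ N]
    [PreconnectedSpace N] {g : N → ℝ}
    (hg : MDifferentiable 𝓘(ℝ, F) 𝓘(ℝ, ℝ) g) (h : ∀ x, mfderiv 𝓘(ℝ, F) 𝓘(ℝ, ℝ) g x = 0) (x y : N) :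
    g x = g y := by
  suffices IsLocallyConstant g from this.apply_eq_of_preconnectedSpace x y
  refine (IsLocallyConstant.iff_eventually_eq g).2 fun x ↦ ?_
  set e := extChartAt 𝓘(ℝ, F) x
  obtain ⟨r, hr, hb⟩ := Metric.mem_nhds_iff.1 (extChartAt_target_mem_nhds (I := 𝓘(ℝ, F)) x)
  have hd : ∀ z ∈ Metric.ball (e x) r, HasFDerivAt (g ∘ e.symm) (0 : F →L[ℝ] ℝ) z := by
    intro z hz
    have h1 : MDifferentiableAt 𝓘(ℝ, F) 𝓘(ℝ, F) e.symm z := by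
      have := mdifferentiableWithinAt_extChartAt_symm (I := 𝓘(ℝ, F)) (hb hz)
      rwa [ModelWithCorners.range_eq_univ, mdifferentiableWithinAt_univ] at this
    have h2 := (hg (e.symm z)).hasMFDerivAt
    rw [h] at h2
    have h3 := (h2.comp z h1.hasMFDerivAt).hasFDerivAt
    rwa [ContinuousLinearMap.zero_comp] at h3
  filter_upwards [(continuousAt_extChartAt (I := 𝓘(ℝ, F)) x).preimage_mem_nhds
    (Metric.ball_mem_nhds _ hr), extChartAt_source_mem_nhds (I := 𝓘(ℝ, F)) x] with x' h1 h2
  have := (convex_ball (e x) r).is_const_of_fderivWithin_eq_zero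
    (fun z hz ↦ (hd z hz).differentiableAt.differentiableWithinAt)
    (fun z hz ↦ by rw [fderivWithin_of_isOpen Metric.isOpen_ball hz, (hd z hz).fderiv]) h1
    (Metric.mem_ball_self hr)
  simp only [Function.comp, e] at this
  rwa [(extChartAt 𝓘(ℝ, F) x).left_inv h2, extChartAt_to_inv] at this

end WarpedGeometry

end SasakianWarped

theorem theorem3
    {E : Type*} [NormedAddCommGroup E] [NormedSpace ℝ E] [FiniteDimensional ℝ E]
    {M : Type*} [TopologicalSpace M] [ChartedSpace E M] [IsManifold 𝓘(ℝ, E) ∞ M]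
    [Bundle.RiemannianBundle (fun q : M ↦ TangentSpace 𝓘(ℝ, E) q)]
    [IsContMDiffRiemannianBundle 𝓘(ℝ, E) ∞ E (fun q : M ↦ TangentSpace 𝓘(ℝ, E) q)]
    {E₁ : Type*} [NormedAddCommGroup E₁] [NormedSpace ℝ E₁] [FiniteDimensional ℝ E₁]
    {MT : Type*} [TopologicalSpace MT] [ChartedSpace E₁ MT] [IsManifold 𝓘(ℝ, E₁) ∞ MT]
    [Bundle.RiemannianBundle (fun p : MT ↦ TangentSpace 𝓘(ℝ, E₁) p)]
    [IsContMDiffRiemannianBundle 𝓘(ℝ, E₁) ∞ E₁ (fun p : MT ↦ TangentSpace 𝓘(ℝ, E₁) p)]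
    {E₂ : Type*} [NormedAddCommGroup E₂] [NormedSpace ℝ E₂] [FiniteDimensional ℝ E₂]
    {Mθ : Type*} [TopologicalSpace Mθ] [ChartedSpace E₂ Mθ] [IsManifold 𝓘(ℝ, E₂) ∞ Mθ]
    [Bundle.RiemannianBundle (fun p : Mθ ↦ TangentSpace 𝓘(ℝ, E₂) p)]
    [IsContMDiffRiemannianBundle 𝓘(ℝ, E₂) ∞ E₂ (fun p : Mθ ↦ TangentSpace 𝓘(ℝ, E₂) p)]
    [ConnectedSpace MT]
    (S : SasakianWarped.AlmostContactMetricStructure E M) (hS : S.IsSasakian)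
    (nabla : CovariantDerivative 𝓘(ℝ, E) E (fun q : M ↦ TangentSpace 𝓘(ℝ, E) q))
    (hnabla : SasakianWarped.IsLeviCivita nabla)
    (f : MT → ℝ) (ι : MT × Mθ → M)
    (hι : SasakianWarped.IsWarpedProductPointwiseSemiSlant E₁ E₂ S f ι)
    (hmixed : SasakianWarped.IsMixedTotallyGeodesic E₁ E₂ S nabla ι) :
    SasakianWarped.IsContactCRWarpedProduct E₁ E₂ S f ι ∨ ∃ c : ℝ, ∀ x : MT, f x = c := by
  by_cases hξ : ∀ p : MT × Mθ,
      S.ξ (ι p) ∈ SasakianWarped.tangentRange E 𝓘(ℝ, E₁) (fun x : MT ↦ ι (x, p.2)) p.1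
  · exact Or.inl ⟨hι.warped, fun y x ↦ hξ (x, y), hι.invariant, hι.isAntiInvariant_right hS.1 hξ⟩
  · right
    push Not at hξ
    obtain ⟨⟨x₀, y₀⟩, h₀⟩ := hξ
    have hclopen := hι.isClopen_setOf_reeb_left
    -- Only `MT` is connected, so the clopen set is restricted to the single leaf `MT × {y₀}`. This
    -- suffices because `f` depends on `x` alone.
    have hleaf : ∀ x : MT, S.ξ (ι (x, y₀)) ∉
        SasakianWarped.tangentRange E 𝓘(ℝ, E₁) (fun x : MT ↦ ι (x, y₀)) x := by
      have h1 := (hclopen.compl.preimage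
        (f := fun x : MT ↦ (x, y₀)) (by fun_prop)).eq_univ ⟨x₀, h₀⟩
      exact fun x ↦ (Set.ext_iff.1 h1 x).2 trivial
    refine ⟨f x₀, fun x ↦ SasakianWarped.eq_of_mfderiv_eq_zero
      (fun x ↦ (hι.warped.smooth_f x).mdifferentiableAt (by simp)) (fun x ↦ ?_) x x₀⟩
    refine hι.mfderiv_f_eq_zero hS.1 (x, y₀) ?_
    -- Openness in the whole product makes `η` vanish on the invariant leaves at all nearby points,
    -- including those off `MT × {y₀}`.
    filter_upwards [hclopen.compl.isOpen.mem_nhds (hleaf x)] with p hp h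
    by_contra hh
    exact hp (hι.ξ_mem_left hh)
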